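/- Let $q$ be a prime power. For integers $v,d,k\ge 0$ let $A_q(v,d;k)$ denote the maximum cardinality of a set $\mathcal{C}$ of $k$-dimensional subspaces of $\mathbb{F}_q^v$ such that any two distinct $U,W\in\mathcal{C}$ have subspace distance $\dim(U+W)-\dim(U\cap W)\ge d$. Then $$A_q(12,4;4)\ge q^{24}+q^{20}+q^{19}+3q^{18}+2q^{17}+3q^{16}+q^{15}+q^{14}+q^{12}+q^{10}+2q^8+2q^6+2q^4+q^2+1$$ and $$A_q(13,4;4)\ge q^{27}+q^{23}+q^{22}+3q^{21}+2q^{20}+3q^{19}+q^{18}+q^{17}+q^{15}+q^{12}+q^{10}+q^9+q^8+q^7+q^6+q^5+q^3.$$ -/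

import Mathlib

/-- The subspace distance `dim (U + W) - dim (U ∩ W)`. The subtraction never truncates
on finite-dimensional spaces, see `subspaceDist_add`. -/
noncomputable def subspaceDist {K V : Type*} [Field K] [AddCommGroup V] [Module K V]
    (U W : Submodule K V) : ℕ :=
  Module.finrank K (U ⊔ W : Submodule K V) - Module.finrank K (U ⊓ W : Submodule K V)

theorem subspaceDist_add {K V : Type*} [Field K] [AddCommGroup V] [Module K V]
    [FiniteDimensional K V] (U W : Submodule K V) :
    subspaceDist U W + Module.finrank K (U ⊓ W : Submodule K V)
      = Module.finrank K (U ⊔ W : Submodule K V) :=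
  Nat.sub_add_cancel (Submodule.finrank_mono (inf_le_left.trans le_sup_left))

/-- `C` is a constant dimension code in `K ^ v`: a finite set of `k`-dimensional subspaces, any two
distinct ones of which have subspace distance at least `d`. -/
def IsConstDimCode {K : Type*} [Field K] (v d k : ℕ)
    (C : Finset (Submodule K (Fin v → K))) : Prop :=
  (∀ U ∈ C, Module.finrank K U = k) ∧
    ∀ U ∈ C, ∀ W ∈ C, U ≠ W → d ≤ subspaceDist U W

/-- `A_q(v,d;k)` for the finite field `K` with `q` elements: the maximum cardinality of a constant
dimension code in `K ^ v` with dimension `k` and minimum subspace distance at least `d`.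
The maximum is attained, see `maxCodeSize_isGreatest`. -/
noncomputable def maxCodeSize (K : Type*) [Field K] (v d k : ℕ) : ℕ :=
  sSup {N : ℕ | ∃ C : Finset (Submodule K (Fin v → K)), IsConstDimCode v d k C ∧ C.card = N}

theorem maxCodeSize_isGreatest (K : Type*) [Field K] [Finite K] (v d k : ℕ) :
    IsGreatest {N : ℕ | ∃ C : Finset (Submodule K (Fin v → K)),
      IsConstDimCode v d k C ∧ C.card = N} (maxCodeSize K v d k) := by
  have hb : BddAbove {N : ℕ | ∃ C : Finset (Submodule K (Fin v → K)),
      IsConstDimCode v d k C ∧ C.card = N} := by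
    have : Finite (Submodule K (Fin v → K)) :=
      Finite.of_injective (fun U => (U : Set (Fin v → K))) SetLike.coe_injective
    have := Fintype.ofFinite (Submodule K (Fin v → K))
    refine ⟨Fintype.card (Submodule K (Fin v → K)), ?_⟩
    rintro N ⟨C, -, rfl⟩
    exact Finset.card_le_univ C
  have hne : {N : ℕ | ∃ C : Finset (Submodule K (Fin v → K)),
      IsConstDimCode v d k C ∧ C.card = N}.Nonempty :=
    ⟨0, ∅, by simp [IsConstDimCode], rfl⟩
  exact ⟨Nat.sSup_mem hne hb, fun N hN => le_csSup hb hN⟩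

/-! Write the ambient space as `T × S`, with `T` of dimension 8 and `S` of dimension 4 or 5.
Subspace distance at least 4 between 4-spaces means that they meet in dimension at most 2. Two kinds
of codewords are used.

Lifted words: graphs over the words of a code in `T` of linear maps to `S` taken from a maximum rank
distance (Gabidulin) code; they meet `0 × S` trivially. Glued words: for a line `L` of `S`, a line
`U` of `T` and `f : U → S`, the space of all `(x, f x + l)` with `l ∈ L`. Its projection to `T` is
`U` and its intersection with `0 × S` is `L`, so it meets every lifted word in dimension at most 2.
Two pairs `(L, U)`, `(L', U')` are compatible when `dim (L ∩ L') + dim (U ∩ U') ≤ 2`; over one pair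
the maps form a rank metric code modulo `L`.

Taking `L` and `U` from partial line spreads makes all pairs compatible, which gives dimensions 12
and 13 from a code in dimension 8. That code comes from the same construction on 4 + 4, with `L` and
`U` in the same class of a parallelism: distinct classes share no line, so there the sum is at most
1 + 1.

For `q > 2` the parallelism consists of a Desarguesian spread of `E × E`, with `E` quadratic over
`k`, and `q ^ 2 + q` images of one Hall spread under shears. For `q = 2` it is explicit. -/

/-! ### Linearized polynomials and rank metric codes -/

section Linearized

variable (k E : Type*) [Field k] [Finite k] [Field E] [Algebra k E]

/-- The `k`-linear map `x ↦ ∑ i, c i * x ^ (q ^ i)` on an extension of the field with `q` elements. -/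
noncomputable def linearizedMap (r : ℕ) : (Fin r → E) →ₗ[k] E →ₗ[k] E :=
  letI := Fintype.ofFinite k
  ∑ i : Fin r, ((LinearMap.mul k E).compr₂ LinearMap.id).compl₂
    (FiniteField.frobeniusAlgHom k E ^ (i : ℕ)).toLinearMap ∘ₗ LinearMap.proj i

variable {k E}

theorem linearizedMap_apply {r : ℕ} (c : Fin r → E) (x : E) :
    linearizedMap k E r c x = ∑ i, c i * x ^ (Nat.card k ^ (i : ℕ)) := by
  let := Fintype.ofFinite k
  simp [linearizedMap, LinearMap.sum_apply, AlgHom.coe_pow, FiniteField.coe_frobeniusAlgHom,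
    pow_iterate]

/-- The kernel lies in the root set of a nonzero polynomial of degree at most `q ^ (r - 1)`, and its
cardinality is `q` to its dimension. -/
theorem finrank_ker_linearizedMap_lt [Finite E] {r : ℕ} {c : Fin r → E} (hc : c ≠ 0) :
    Module.finrank k (LinearMap.ker (linearizedMap k E r c)) < r := by
  classical
  have hq : 1 < Nat.card k := Finite.one_lt_card
  obtain ⟨i₀, hi₀⟩ := Function.ne_iff.mp hc
  let p : Polynomial E := ∑ i : Fin r, Polynomial.monomial (Nat.card k ^ (i : ℕ)) (c i)
  have hp : p ≠ 0 := by
    intro h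
    apply hi₀
    have := congrArg (fun f => Polynomial.coeff f (Nat.card k ^ (i₀ : ℕ))) h
    simpa [p, Polynomial.coeff_monomial, Nat.pow_right_inj hq, Fin.val_inj] using this
  have hr : 0 < r := i₀.pos
  have hdeg : p.natDegree ≤ Nat.card k ^ (r - 1) := by
    refine Polynomial.natDegree_sum_le_of_forall_le _ _ fun i _ => ?_
    exact (Polynomial.natDegree_monomial_le _).trans
      (Nat.pow_le_pow_right hq.le (by have := i.2; omega))
  have hroot : ∀ x ∈ LinearMap.ker (linearizedMap k E r c), x ∈ p.roots.toFinset := by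
    intro x hx
    rw [LinearMap.mem_ker, linearizedMap_apply] at hx
    simp [hp, p, Polynomial.eval_finsetSum, Polynomial.eval_monomial, hx]
  have hcard : Nat.card (LinearMap.ker (linearizedMap k E r c)) ≤ Nat.card k ^ (r - 1) := by
    have h1 := Nat.card_mono (s := (LinearMap.ker (linearizedMap k E r c) : Set E))
      (t := (p.roots.toFinset : Set E)) (Finset.finite_toSet _) hroot
    refine le_trans h1 ?_
    rw [Nat.card_eq_card_toFinset, Finset.toFinset_coe]
    exact (Multiset.toFinset_card_le _).trans (p.card_roots'.trans hdeg)
  have : Module.Finite k E := Module.Finite.of_finite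
  rw [Module.natCard_eq_pow_finrank (K := k), Nat.pow_le_pow_iff_right hq] at hcard
  omega

end Linearized

theorem exists_finite_extension (k : Type*) [Field k] [Finite k] (n : ℕ) (hn : n ≠ 0) :
    ∃ (E : Type) (_ : Field E) (_ : Finite E) (_ : Algebra k E), Module.finrank k E = n := by
  obtain ⟨p, hp⟩ := CharP.exists k
  have : Fact p.Prime := ⟨CharP.char_is_prime k p⟩
  have : NeZero n := ⟨hn⟩
  exact ⟨FiniteField.Extension k p n, inferInstance, inferInstance, inferInstance,
    FiniteField.finrank_extension k p n⟩

/-- Existence of maximum rank distance codes: if `dim U ≤ dim S`, there are `q ^ (dim S * r)` linear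
maps from `U` to `S` such that the difference of any two has kernel of dimension less than `r`. -/
theorem exists_rankMetricCode {k U S : Type*} [Field k] [Finite k] [AddCommGroup U] [Module k U]
    [AddCommGroup S] [Module k S] [Module.Finite k U] [Module.Finite k S] {n : ℕ} (r : ℕ)
    (hU : Module.finrank k U ≤ n) (hS : Module.finrank k S = n) :
    ∃ M : Fin (Nat.card k ^ (n * r)) → U →ₗ[k] S,
      ∀ i j, i ≠ j → Module.finrank k (LinearMap.ker (M i - M j)) < r := by
  rcases Nat.eq_zero_or_pos n with rfl | hn
  · exact ⟨fun _ => 0, fun i j hij => absurd (by ext; have := i.2; have := j.2; simp_all) hij⟩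
  obtain ⟨E, _, _, _, hE⟩ := exists_finite_extension k n hn.ne'
  have : Module.Finite k E := Module.Finite.of_finite
  -- Linearized maps of `E` are restricted along an embedding `U → E`, which cannot enlarge kernels,
  -- and then transported to `S ≃ E`.
  obtain ⟨e, he⟩ : ∃ e : U →ₗ[k] E, Function.Injective e := by
    rw [← lift_rank_le_iff_exists_linearMap, ← Module.finrank_eq_rank k U,
      ← Module.finrank_eq_rank k E]
    simpa [-Module.finrank_eq_rank] using hU.trans hE.ge
  let φ : E ≃ₗ[k] S := LinearEquiv.ofFinrankEq _ _ (hE.trans hS.symm)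
  have hcard : Nat.card (Fin r → E) = Nat.card k ^ (n * r) := by
    rw [Nat.card_fun, Module.natCard_eq_pow_finrank (K := k) (V := E), hE]
    simp [pow_mul]
  let ψ : Fin (Nat.card k ^ (n * r)) ≃ (Fin r → E) := (Finite.equivFinOfCardEq hcard).symm
  refine ⟨fun i => φ.toLinearMap ∘ₗ linearizedMap k E r (ψ i) ∘ₗ e, fun i j hij => ?_⟩
  have hne : ψ i - ψ j ≠ 0 := sub_ne_zero.mpr (ψ.injective.ne hij)
  refine lt_of_le_of_lt ?_ (finrank_ker_linearizedMap_lt (k := k) hne)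
  have hmem : ∀ x ∈ LinearMap.ker (φ.toLinearMap ∘ₗ linearizedMap k E r (ψ i) ∘ₗ e -
      φ.toLinearMap ∘ₗ linearizedMap k E r (ψ j) ∘ₗ e),
      e x ∈ LinearMap.ker (linearizedMap k E r (ψ i - ψ j)) := by
    intro x hx
    rw [LinearMap.mem_ker] at hx ⊢
    apply φ.injective
    simpa using hx
  exact LinearMap.finrank_le_finrank_of_injective (f := e.restrict hmem)
    fun x y hxy => Subtype.ext (he (congrArg Subtype.val hxy))

/-! ### Gluing a subspace of `S` to a subspace of `T` -/

section Twist

variable {k T S : Type*} [Field k] [AddCommGroup T] [Module k T] [AddCommGroup S] [Module k S]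

/-- The subspace of all `(x, f x + l)` with `x ∈ U` and `l ∈ L`. -/
def twist (U : Submodule k T) (f : U →ₗ[k] S) (L : Submodule k S) : Submodule k (T × S) :=
  LinearMap.range ((U.subtype ∘ₗ LinearMap.fst k U L).prod (f.coprod L.subtype))

theorem mem_twist {U : Submodule k T} {f : U →ₗ[k] S} {L : Submodule k S} {z : T × S} :
    z ∈ twist U f L ↔ ∃ h : z.1 ∈ U, z.2 - f ⟨z.1, h⟩ ∈ L := by
  constructor
  · rintro ⟨⟨x, l⟩, rfl⟩
    exact ⟨by simp, by simp⟩
  · rintro ⟨h, hl⟩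
    exact ⟨(⟨z.1, h⟩, ⟨_, hl⟩), by simp⟩

theorem comap_inr_twist (U : Submodule k T) (f : U →ₗ[k] S) (L : Submodule k S) :
    (twist U f L).comap (LinearMap.inr k T S) = L := by
  ext y
  have : (⟨0, U.zero_mem⟩ : U) = 0 := rfl
  simp [mem_twist, this]

variable [Module.Finite k T] [Module.Finite k S]

theorem finrank_twist (U : Submodule k T) (f : U →ₗ[k] S) (L : Submodule k S) :
    Module.finrank k (twist U f L) = Module.finrank k U + Module.finrank k L := by
  rw [twist, LinearMap.finrank_range_of_inj, Module.finrank_prod]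
  rintro ⟨x, l⟩ ⟨x', l'⟩ h
  obtain ⟨h1, h2⟩ := Prod.ext_iff.mp h
  obtain rfl : x = x' := by simpa using h1
  simpa using h2

/-- Rank-nullity for the projection to `T`; every intersection estimate below splits a dimension in
this way. -/
theorem finrank_eq_map_fst_add_comap_inr (X : Submodule k (T × S)) :
    Module.finrank k X = Module.finrank k (X.map (LinearMap.fst k T S))
      + Module.finrank k (X.comap (LinearMap.inr k T S)) := by
  have h := LinearMap.finrank_range_add_finrank_ker ((LinearMap.fst k T S).domRestrict X)
  have hr : LinearMap.range ((LinearMap.fst k T S).domRestrict X) =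
      X.map (LinearMap.fst k T S) := by
    rw [LinearMap.range_domRestrict]
  rw [hr] at h
  rw [← h]
  congr 1
  refine LinearEquiv.finrank_eq (LinearEquiv.ofBijective
    (LinearMap.codRestrict _ (LinearMap.snd k T S ∘ₗ X.subtype ∘ₗ Submodule.subtype _) ?_) ⟨?_, ?_⟩)
  · rintro ⟨⟨⟨x, y⟩, hX⟩, h0⟩
    obtain rfl : x = 0 := h0
    exact hX
  · rintro ⟨⟨⟨x, y⟩, hX⟩, h0⟩ ⟨⟨⟨x', y'⟩, hX'⟩, h0'⟩ h
    obtain rfl : x = 0 := h0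
    obtain rfl : x' = 0 := h0'
    obtain rfl : y = y' := congrArg Subtype.val h
    rfl
  · rintro ⟨y, hy⟩
    exact ⟨⟨⟨(0, y), hy⟩, rfl⟩, rfl⟩

theorem finrank_inf_le_map_fst_add_comap_inr (X Y : Submodule k (T × S)) :
    Module.finrank k (X ⊓ Y : Submodule k (T × S)) ≤
      Module.finrank k (Y.map (LinearMap.fst k T S)) +
        Module.finrank k (X.comap (LinearMap.inr k T S)) := by
  rw [finrank_eq_map_fst_add_comap_inr]
  exact add_le_add (Submodule.finrank_mono (Submodule.map_mono inf_le_right))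
    (Submodule.finrank_mono (Submodule.comap_mono inf_le_left))

theorem finrank_twist_inf_twist_le (U U' : Submodule k T) (f : U →ₗ[k] S) (f' : U' →ₗ[k] S)
    (L L' : Submodule k S) :
    Module.finrank k (twist U f L ⊓ twist U' f' L' : Submodule k (T × S)) ≤
      Module.finrank k (L ⊓ L' : Submodule k S) + Module.finrank k (U ⊓ U' : Submodule k T) := by
  rw [finrank_eq_map_fst_add_comap_inr, add_comm, Submodule.comap_inf, comap_inr_twist,
    comap_inr_twist]
  gcongr
  refine Submodule.finrank_mono ?_
  rintro _ ⟨z, ⟨h, h'⟩, rfl⟩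
  exact ⟨(mem_twist.mp h).1, (mem_twist.mp h').1⟩

/-- A common point over `x` forces `f x - f' x ∈ L`, so only the maps modulo `L` matter. -/
theorem finrank_twist_inf_twist_same_le (U : Submodule k T) (f f' : U →ₗ[k] S)
    (L : Submodule k S) :
    Module.finrank k (twist U f L ⊓ twist U f' L : Submodule k (T × S)) ≤
      Module.finrank k L + Module.finrank k (LinearMap.ker (L.mkQ ∘ₗ f - L.mkQ ∘ₗ f')) := by
  rw [finrank_eq_map_fst_add_comap_inr, add_comm, Submodule.comap_inf, comap_inr_twist,
    comap_inr_twist, inf_idem, ← Submodule.finrank_map_subtype_eq U]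
  gcongr
  refine Submodule.finrank_mono ?_
  rintro _ ⟨⟨x, y⟩, ⟨h, h'⟩, rfl⟩
  obtain ⟨hx, hl⟩ := mem_twist.mp h
  obtain ⟨_, hl'⟩ := mem_twist.mp h'
  refine ⟨⟨x, hx⟩, ?_, rfl⟩
  rw [SetLike.mem_coe, LinearMap.mem_ker, LinearMap.sub_apply, sub_eq_zero]
  simp only [LinearMap.comp_apply, Submodule.mkQ_apply]
  rw [Submodule.Quotient.eq]
  simpa using L.sub_mem hl' hl

theorem finrank_map_fst_inf_map_inr (X : Submodule k (T × S)) (Y : Submodule k S) :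
    Module.finrank k (X ⊓ Y.map (LinearMap.inr k T S) : Submodule k (T × S)) ≤
      Module.finrank k (X.comap (LinearMap.inr k T S)) := by
  refine (finrank_inf_le_map_fst_add_comap_inr _ _).trans ?_
  have h : (Y.map (LinearMap.inr k T S)).map (LinearMap.fst k T S) = ⊥ := by
    rw [← Submodule.map_comp, LinearMap.fst_comp_inr, Submodule.map_zero]
  rw [h, finrank_bot, zero_add]

end Twist

/-- A family of `d`-dimensional subspaces, distinct members of which meet in dimension at most
`a`. -/
structure IsCodeFamily {k V ι : Type*} [Field k] [AddCommGroup V] [Module k V] (d a : ℕ)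
    (W : ι → Submodule k V) : Prop where
  finrank_eq : ∀ i, Module.finrank k (W i) = d
  finrank_inf_le : ∀ i j, i ≠ j → Module.finrank k (W i ⊓ W j : Submodule k V) ≤ a

/-- There is a code of size `N` consisting of `d`-dimensional subspaces that pairwise meet in
dimension at most `a`. -/
def HasCode (k V : Type*) [Field k] [AddCommGroup V] [Module k V] (d a N : ℕ) : Prop :=
  ∃ W : Fin N → Submodule k V, IsCodeFamily d a W

/-! ### Lifting and linkage of codes -/

section Code

variable {k T S : Type*} [Field k] [AddCommGroup T] [Module k T] [AddCommGroup S] [Module k S]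

theorem IsCodeFamily.comp {ι κ : Type*} {d a : ℕ} {W : ι → Submodule k T}
    (hW : IsCodeFamily d a W) {e : κ → ι} (he : Function.Injective e) :
    IsCodeFamily d a (W ∘ e) :=
  ⟨fun _ => hW.1 _, fun _ _ hij => hW.2 _ _ (he.ne hij)⟩

theorem IsCodeFamily.hasCode {ι : Type*} [Finite ι] {d a N : ℕ} {W : ι → Submodule k T}
    (hW : IsCodeFamily d a W) (hN : Nat.card ι = N) : HasCode k T d a N :=
  ⟨W ∘ (Finite.equivFinOfCardEq hN).symm, hW.comp (Equiv.injective _)⟩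

theorem finrank_map_of_injective (e : T →ₗ[k] S) (he : Function.Injective e)
    (U : Submodule k T) : Module.finrank k (U.map e) = Module.finrank k U :=
  (Submodule.equivMapOfInjective e he U).finrank_eq.symm

theorem IsCodeFamily.map {ι : Type*} {d a : ℕ} {W : ι → Submodule k T} (hW : IsCodeFamily d a W)
    (e : T →ₗ[k] S) (he : Function.Injective e) : IsCodeFamily d a fun i => (W i).map e := by
  refine ⟨fun i => ?_, fun i j hij => ?_⟩
  · rw [finrank_map_of_injective e he, hW.1]
  · rw [← Submodule.map_inf _ he, finrank_map_of_injective e he]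
    exact hW.2 i j hij

theorem IsCodeFamily.sumElim {ι κ : Type*} {d a : ℕ} {W : ι → Submodule k T}
    {X : κ → Submodule k T} (hW : IsCodeFamily d a W) (hX : IsCodeFamily d a X)
    (h : ∀ i j, Module.finrank k (W i ⊓ X j : Submodule k T) ≤ a) :
    IsCodeFamily d a (Sum.elim W X) := by
  refine ⟨?_, ?_⟩
  · rintro (i | i)
    exacts [hW.1 i, hX.1 i]
  · rintro (i | i) (j | j) hij
    · exact hW.2 i j fun h => hij (h ▸ rfl)
    · exact h i j
    · rw [inf_comm]
      exact h j i
    · exact hX.2 i j fun h => hij (h ▸ rfl)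

theorem HasCode.of_finrank_eq [Module.Finite k T] [Module.Finite k S] {d a N : ℕ}
    (h : HasCode k T d a N) (hTS : Module.finrank k T = Module.finrank k S) :
    HasCode k S d a N := by
  obtain ⟨W, hW⟩ := h
  exact ⟨_, hW.map (LinearEquiv.ofFinrankEq T S hTS).toLinearMap (LinearEquiv.injective _)⟩

variable [Finite k] [Module.Finite k T] [Module.Finite k S]

/-- Over one index `p`, a rank metric code of maps into `S ⧸ L p`, pulled back along a section of
the quotient map, bounds intersections by `l + (r - 1)`. Different indices are separated by `hLU`,
whatever the maps are. -/
theorem exists_twist_family {P : Type*} {u l r a n : ℕ} (L : P → Submodule k S)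
    (U : P → Submodule k T) (hL : ∀ p, Module.finrank k (L p) = l)
    (hU : ∀ p, Module.finrank k (U p) = u)
    (hLU : ∀ p p', p ≠ p' → Module.finrank k (L p ⊓ L p' : Submodule k S) +
      Module.finrank k (U p ⊓ U p' : Submodule k T) ≤ a)
    (hr : l + r ≤ a + 1) (hn : Module.finrank k S = n + l) (hun : u ≤ n) :
    ∃ W : P × Fin (Nat.card k ^ (n * r)) → Submodule k (T × S), IsCodeFamily (u + l) a W ∧
      ∀ i, Module.finrank k ((W i).comap (LinearMap.inr k T S)) = l := by
  have hM : ∀ p, ∃ M : Fin (Nat.card k ^ (n * r)) → U p →ₗ[k] S, ∀ i j, i ≠ j →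
      Module.finrank k (LinearMap.ker ((L p).mkQ ∘ₗ M i - (L p).mkQ ∘ₗ M j)) < r := by
    intro p
    have hq : Module.finrank k (S ⧸ L p) = n := by
      have := (L p).finrank_quotient_add_finrank
      have := hL p
      omega
    obtain ⟨M, hM⟩ := exists_rankMetricCode r ((hU p).trans_le hun) hq
    obtain ⟨g, hg⟩ := (L p).mkQ.exists_rightInverse_of_surjective (L p).range_mkQ
    refine ⟨fun i => g ∘ₗ M i, fun i j hij => ?_⟩
    rw [← LinearMap.comp_assoc, ← LinearMap.comp_assoc, hg]
    exact hM i j hij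
  choose M hM using hM
  refine ⟨fun i => twist (U i.1) (M i.1 i.2) (L i.1), ⟨fun i => ?_, ?_⟩, fun i => ?_⟩
  · rw [finrank_twist, hL, hU]
  · rintro ⟨p, i⟩ ⟨p', j⟩ hij
    by_cases hp : p = p'
    · subst hp
      have h1 := hM p i j fun h => hij (h ▸ rfl)
      have h2 := finrank_twist_inf_twist_same_le (U p) (M p i) (M p j) (L p)
      have := hL p
      dsimp only
      omega
    · exact (finrank_twist_inf_twist_le _ _ _ _ _ _).trans (hLU p p' hp)
  · rw [comap_inr_twist, hL]

/-- A code in `T` lifts to a code in `T × S` whose members meet `0 × S` trivially. -/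
theorem IsCodeFamily.exists_lift {ι : Type*} {d a n : ℕ} {U : ι → Submodule k T}
    (hU : IsCodeFamily d a U) (hn : Module.finrank k S = n) (hd : d ≤ n) :
    ∃ W : ι × Fin (Nat.card k ^ (n * (a + 1))) → Submodule k (T × S),
      IsCodeFamily d a W ∧ ∀ i, Module.finrank k ((W i).comap (LinearMap.inr k T S)) = 0 :=
  exists_twist_family (l := 0) (fun _ => ⊥) U (fun _ => finrank_bot k S) hU.1
    (fun p p' h => by
      rw [bot_inf_eq, finrank_bot, zero_add]
      exact hU.2 _ _ h) (by omega) hn hd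

/-- Adding two dimensions to a partial line spread. -/
theorem HasCode.line_spread_step {n N : ℕ} (hn : Module.finrank k S = n) (h2 : 2 ≤ n)
    (hT : Module.finrank k T = 2) (h : HasCode k S 2 0 N) :
    HasCode k (T × S) 2 0 (Nat.card k ^ n + N) := by
  obtain ⟨X, hX⟩ := h
  have hU : IsCodeFamily 2 0 (fun _ : Unit => (⊤ : Submodule k T)) :=
    ⟨fun _ => by rw [finrank_top, hT], fun i j hij => absurd rfl hij⟩
  obtain ⟨W, hW, hW0⟩ := hU.exists_lift hn h2
  refine (hW.sumElim (hX.map (LinearMap.inr k T S) LinearMap.inr_injective) fun i j =>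
    (finrank_map_fst_inf_map_inr _ _).trans (hW0 i).le).hasCode ?_
  simp

/-- The generalized linkage construction: a code in `T` is lifted, and lines `L p` of `S` are glued
to lines `U p` of `T`. -/
theorem exists_linkage_family {P : Type*} {N s : ℕ} (hs : Module.finrank k S = s + 2) (h2 : 2 ≤ s)
    (hT : HasCode k T 4 2 N) (L : P → Submodule k S) (U : P → Submodule k T)
    (hL : ∀ p, Module.finrank k (L p) = 2) (hU : ∀ p, Module.finrank k (U p) = 2)
    (hLU : ∀ p p', p ≠ p' → Module.finrank k (L p ⊓ L p' : Submodule k S) +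
      Module.finrank k (U p ⊓ U p' : Submodule k T) ≤ 2) :
    ∃ W : (Fin N × Fin (Nat.card k ^ ((s + 2) * 3))) ⊕ (P × Fin (Nat.card k ^ (s * 1))) →
      Submodule k (T × S), IsCodeFamily 4 2 W ∧
        ∀ i, Module.finrank k ((W i).comap (LinearMap.inr k T S)) ≤ 2 := by
  obtain ⟨C, hC⟩ := hT
  obtain ⟨W, hW, hW0⟩ := hC.exists_lift hs (by omega)
  obtain ⟨X, hX, hX2⟩ := exists_twist_family (r := 1) (a := 2) L U hL hU hLU le_rfl hs h2
  refine ⟨Sum.elim W X, hW.sumElim hX fun i j => ?_, ?_⟩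
  -- The glued word projects to dimension 4 - 2 = 2 in `T`, and the lifted word contributes nothing
  -- inside `0 × S`.
  · refine (finrank_inf_le_map_fst_add_comap_inr _ _).trans ?_
    have h1 := finrank_eq_map_fst_add_comap_inr (X j)
    have h2 := hX.1 j
    have h3 := hX2 j
    have h4 := hW0 i
    omega
  · rintro (i | i)
    · exact (hW0 i).trans_le (by norm_num)
    · exact (hX2 i).le

theorem HasCode.linkage {P : Type*} [Finite P] {N s : ℕ} (hs : Module.finrank k S = s + 2)
    (h2 : 2 ≤ s) (hT : HasCode k T 4 2 N) (L : P → Submodule k S) (U : P → Submodule k T)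
    (hL : ∀ p, Module.finrank k (L p) = 2) (hU : ∀ p, Module.finrank k (U p) = 2)
    (hLU : ∀ p p', p ≠ p' → Module.finrank k (L p ⊓ L p' : Submodule k S) +
      Module.finrank k (U p ⊓ U p' : Submodule k T) ≤ 2) :
    HasCode k (T × S) 4 2 (N * Nat.card k ^ ((s + 2) * 3) + Nat.card P * Nat.card k ^ s) := by
  obtain ⟨W, hW, -⟩ := exists_linkage_family hs h2 hT L U hL hU hLU
  exact hW.hasCode (by simp [Nat.card_sum, Nat.card_prod])

/-- If `S` has dimension four, then the subspace `0 × S` itself extends the linkage code. -/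
theorem HasCode.linkage_succ {P : Type*} [Finite P] {N : ℕ} (hs : Module.finrank k S = 4)
    (hT : HasCode k T 4 2 N) (L : P → Submodule k S) (U : P → Submodule k T)
    (hL : ∀ p, Module.finrank k (L p) = 2) (hU : ∀ p, Module.finrank k (U p) = 2)
    (hLU : ∀ p p', p ≠ p' → Module.finrank k (L p ⊓ L p' : Submodule k S) +
      Module.finrank k (U p ⊓ U p' : Submodule k T) ≤ 2) :
    HasCode k (T × S) 4 2 (N * Nat.card k ^ 12 + Nat.card P * Nat.card k ^ 2 + 1) := by
  obtain ⟨W, hW, hW2⟩ := exists_linkage_family hs le_rfl hT L U hL hU hLU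
  have hS : IsCodeFamily 4 2 (fun _ : Unit => (⊤ : Submodule k S)) :=
    ⟨fun _ => by rw [finrank_top, hs], fun i j hij => absurd rfl hij⟩
  refine (hW.sumElim (hS.map (LinearMap.inr k T S) LinearMap.inr_injective) fun i j =>
    (finrank_map_fst_inf_map_inr _ _).trans (hW2 i)).hasCode ?_
  simp [Nat.card_sum, Nat.card_prod]

end Code

/-- A parallelism of a four-dimensional space: a family of `q ^ 2 + q + 1` line spreads, no two of
which have a line in common. -/
def HasParallelism (k V : Type*) [Field k] [AddCommGroup V] [Module k V] : Prop :=
  ∃ P : Fin (Nat.card k ^ 2 + Nat.card k + 1) → Fin (Nat.card k ^ 2 + 1) → Submodule k V,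
    (∀ i, IsCodeFamily 2 0 (P i)) ∧ ∀ i i', i ≠ i' → ∀ j j', P i j ≠ P i' j'

/-! ### Parallelisms from Desarguesian and Hall spreads -/

section QuadraticExtension

variable {k E : Type*} [Field k] [Field E] [Algebra k E]

/-- The line `y = c x + d φ(x)` of `E × E`, where `E` is a quadratic extension of `k`. -/
def graphLine (φ : E ≃ₐ[k] E) (c d : E) : Submodule k (E × E) :=
  LinearMap.range (LinearMap.id.prod
    (LinearMap.mulLeft k c + LinearMap.mulLeft k d ∘ₗ φ.toLinearMap))

theorem mem_graphLine {φ : E ≃ₐ[k] E} {c d : E} {z : E × E} :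
    z ∈ graphLine φ c d ↔ z.2 = c * z.1 + d * φ z.1 := by
  constructor
  · rintro ⟨x, rfl⟩
    simp
  · intro h
    exact ⟨z.1, Prod.ext rfl (by simp [h])⟩

theorem finrank_graphLine (φ : E ≃ₐ[k] E) (c d : E) :
    Module.finrank k (graphLine φ c d) = Module.finrank k E :=
  LinearMap.finrank_range_of_inj fun _ _ h => congrArg Prod.fst h

variable (k) in
/-- The scalar multiple `μ (k × k)` of the standard Baer line of `E × E`. -/
def scaledLine (μ : E) : Submodule k (E × E) :=
  LinearMap.range ((LinearMap.toSpanSingleton k E μ).prodMap (LinearMap.toSpanSingleton k E μ))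

theorem mem_scaledLine {μ : E} {z : E × E} :
    z ∈ scaledLine k μ ↔ ∃ u v : k, u • μ = z.1 ∧ v • μ = z.2 := by
  constructor
  · rintro ⟨⟨u, v⟩, rfl⟩
    exact ⟨u, v, rfl, rfl⟩
  · rintro ⟨u, v, h1, h2⟩
    exact ⟨(u, v), Prod.ext h1 h2⟩

theorem finrank_scaledLine {μ : E} (hμ : μ ≠ 0) : Module.finrank k (scaledLine k μ) = 2 := by
  rw [scaledLine, LinearMap.finrank_range_of_inj, Module.finrank_prod, Module.finrank_self]
  rintro ⟨u, v⟩ ⟨u', v'⟩ h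
  obtain ⟨h1, h2⟩ := Prod.ext_iff.mp h
  exact Prod.ext (smul_left_injective k hμ h1) (smul_left_injective k hμ h2)

variable (k) in
/-- The map `(x, y) ↦ (a x, b x + y)`. -/
def shear (a b : E) : E × E →ₗ[k] E × E :=
  (LinearMap.mulLeft k a ∘ₗ LinearMap.fst k E E).prod
    (LinearMap.mulLeft k b ∘ₗ LinearMap.fst k E E + LinearMap.snd k E E)

theorem shear_apply (a b : E) (z : E × E) : shear k a b z = (a * z.1, b * z.1 + z.2) := rfl

theorem shear_injective {a : E} (ha : a ≠ 0) (b : E) : Function.Injective (shear k a b) := by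
  rintro ⟨x, y⟩ ⟨x', y'⟩ h
  obtain ⟨h1, h2⟩ := Prod.ext_iff.mp h
  obtain rfl : x = x' := mul_left_cancel₀ ha h1
  exact Prod.ext rfl (add_left_cancel h2)

/-- Representatives of the one-dimensional `k`-subspaces of the span of `1` and `ω`. -/
def projPoint (ω : E) : Option k → E
  | none => 1
  | some x => ω + algebraMap k E x

theorem projPoint_ne_zero {ω : E} (hω : ω ∉ Set.range (algebraMap k E)) (m : Option k) :
    projPoint ω m ≠ 0 := by
  rcases m with _ | x
  · exact one_ne_zero
  · intro h
    exact hω ⟨-x, by rw [map_neg]; exact (eq_neg_of_add_eq_zero_left h).symm⟩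

theorem eq_zero_of_smul_mem_range {ω : E} (hω : ω ∉ Set.range (algebraMap k E)) {x y : k}
    (h : x • ω = algebraMap k E y) : x = 0 := by
  by_contra hx
  refine hω ⟨x⁻¹ * y, ?_⟩
  rw [map_mul, ← h, Algebra.smul_def, ← mul_assoc, ← map_mul, inv_mul_cancel₀ hx, map_one, one_mul]

/-- `1` and `ω` are independent over `k`, so comparing coordinates shows that distinct
representatives are never proportional. -/
theorem projPoint_eq_smul {ω : E} (hω : ω ∉ Set.range (algebraMap k E)) {m m' : Option k} {u : k}
    (h : projPoint ω m = u • projPoint ω m') : m = m' ∧ u = 1 := by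
  rcases m with _ | x <;> rcases m' with _ | x' <;> simp only [projPoint] at h
  · refine ⟨rfl, (algebraMap k E).injective ?_⟩
    rw [map_one, h, Algebra.smul_def, mul_one]
  · have hu : u = 0 := eq_zero_of_smul_mem_range hω (x := u) (y := 1 - u * x') (by
      rw [map_sub, map_mul, map_one, h, smul_add, Algebra.smul_def u (algebraMap k E x')]
      ring)
    simp [hu] at h
  · refine absurd ⟨u - x, ?_⟩ hω
    rw [map_sub, sub_eq_iff_eq_add, h, Algebra.smul_def, mul_one]
  · have hu : 1 - u = 0 := eq_zero_of_smul_mem_range hω (x := 1 - u) (y := u * x' - x) (by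
      simp only [Algebra.smul_def, map_sub, map_mul, map_one] at h ⊢
      linear_combination h)
    obtain rfl : u = 1 := (sub_eq_zero.mp hu).symm
    rw [one_smul] at h
    exact ⟨congrArg some ((algebraMap k E).injective (add_left_cancel h)), rfl⟩

/-- The lines of the Desarguesian spread of `E × E`. -/
def desarguesianSpread (φ : E ≃ₐ[k] E) : Option E → Submodule k (E × E)
  | none => LinearMap.range (LinearMap.inr k E E)
  | some c => graphLine φ c 0

/-- The Hall spread obtained from the Desarguesian spread with the lines
`y = (s + t c) x + t δ φ(x)` by reversing the regulus formed by the lines `y = s x` and `x = 0`. -/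
def hallSpread (φ : E ≃ₐ[k] E) (ω c δ : E) : Option k ⊕ (kˣ × k) → Submodule k (E × E)
  | .inl m => scaledLine k (projPoint ω m)
  | .inr (t, s) => graphLine φ (algebraMap k E s + algebraMap k E t * c) (algebraMap k E t * δ)

theorem finrank_inf_le_zero_of_forall {V : Type*} [AddCommGroup V] [Module k V]
    {X Y : Submodule k V} (h : ∀ z ∈ X, z ∈ Y → z = 0) :
    Module.finrank k (X ⊓ Y : Submodule k V) ≤ 0 := by
  have : X ⊓ Y = ⊥ := (Submodule.eq_bot_iff _).mpr fun z hz => h z hz.1 hz.2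
  rw [this, finrank_bot]

theorem isCodeFamily_desarguesianSpread (φ : E ≃ₐ[k] E) (hE : Module.finrank k E = 2) :
    IsCodeFamily 2 0 (desarguesianSpread φ) := by
  have h0 : ∀ c, ∀ z ∈ LinearMap.range (LinearMap.inr k E E), z ∈ graphLine φ c 0 → z = 0 := by
    rintro c _ ⟨y, rfl⟩ h
    rw [mem_graphLine] at h
    simpa using h
  refine ⟨?_, ?_⟩
  · rintro (_ | c)
    · exact (LinearMap.finrank_range_of_inj LinearMap.inr_injective).trans hE
    · exact (finrank_graphLine _ _ _).trans hE
  · rintro (_ | c) (_ | c') hcc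
    · exact absurd rfl hcc
    · exact finrank_inf_le_zero_of_forall (h0 c')
    · exact finrank_inf_le_zero_of_forall fun z h h' => h0 c z h' h
    · refine finrank_inf_le_zero_of_forall fun z h h' => ?_
      simp only [desarguesianSpread, mem_graphLine, zero_mul, add_zero] at h h'
      have h1 : (c - c') * z.1 = 0 := by rw [sub_mul, ← h, ← h', sub_self]
      have h2 : z.1 = 0 := (mul_eq_zero.mp h1).resolve_left
        (sub_ne_zero.mpr fun e => hcc (congrArg some e))
      exact Prod.ext h2 (by rw [h, h2, mul_zero]; rfl)

/-- Differences of the graph maps, and shifts of them by elements of `k`, again have the form `(s +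
t c) x + t δ φ(x)`; for `t ≠ 0` these are injective by `hc`. -/
theorem isCodeFamily_hallSpread {φ : E ≃ₐ[k] E} {ω c δ : E} (hE : Module.finrank k E = 2)
    (hω : ω ∉ Set.range (algebraMap k E))
    (hc : ∀ (s : k) (z : E), (algebraMap k E s + c) * z + δ * φ z = 0 → z = 0) :
    IsCodeFamily 2 0 (hallSpread φ ω c δ) := by
  have hc' : ∀ (t s : k) (z : E), t ≠ 0 →
      (algebraMap k E s + algebraMap k E t * c) * z + algebraMap k E t * δ * φ z = 0 → z = 0 := by
    intro t s z ht h
    refine hc (t⁻¹ * s) z ?_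
    have ht' : algebraMap k E t ≠ 0 := (map_ne_zero _).mpr ht
    refine (mul_eq_zero.mp ?_).resolve_left ht'
    rw [map_mul, map_inv₀, ← h]
    field_simp
  have h0 : ∀ (m : Option k) (i : kˣ × k), ∀ z ∈ hallSpread φ ω c δ (.inl m),
      z ∈ hallSpread φ ω c δ (.inr i) → z = 0 := by
    rintro m ⟨t, s⟩ ⟨x, y⟩ h h'
    obtain ⟨u, v, rfl, rfl⟩ := mem_scaledLine.mp h
    rw [hallSpread, mem_graphLine] at h'
    have hμ := projPoint_ne_zero hω m
    have hu : u = 0 := by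
      by_contra hu
      -- The point `(u μ, v μ)` has slope `v / u` in `k`, which is absorbed into the parameter `s`.
      refine hμ (hc' t (s - u⁻¹ * v) _ t.ne_zero ?_)
      have hu' : algebraMap k E u ≠ 0 := (map_ne_zero _).mpr hu
      refine (mul_eq_zero.mp ?_).resolve_left hu'
      simp only [Algebra.smul_def, map_mul, AlgEquiv.commutes, map_sub, map_inv₀] at h' ⊢
      field_simp
      linear_combination -h'
    subst hu
    simpa [hμ] using h'
  refine ⟨?_, ?_⟩
  · rintro (m | ⟨t, s⟩)
    · exact finrank_scaledLine (projPoint_ne_zero hω m)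
    · exact (finrank_graphLine _ _ _).trans hE
  · rintro (m | i) (m' | i') hij
    · refine finrank_inf_le_zero_of_forall ?_
      rintro ⟨x, y⟩ h h'
      obtain ⟨u, v, rfl, rfl⟩ := mem_scaledLine.mp h
      obtain ⟨u', v', h1, h2⟩ := mem_scaledLine.mp h'
      have key : ∀ w w' : k, w' • projPoint ω m' = w • projPoint ω m → w = 0 := by
        intro w w' hw
        by_contra h0
        refine hij (congrArg _ (projPoint_eq_smul hω (u := w⁻¹ * w') ?_).1)
        rw [mul_smul, hw, smul_smul, inv_mul_cancel₀ h0, one_smul]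
      rw [key u u' h1, key v v' h2, zero_smul]
      rfl
    · exact finrank_inf_le_zero_of_forall (h0 m i')
    · exact finrank_inf_le_zero_of_forall fun z h h' => h0 m' i z h' h
    · obtain ⟨t, s⟩ := i
      obtain ⟨t', s'⟩ := i'
      refine finrank_inf_le_zero_of_forall ?_
      rintro ⟨x, y⟩ h h'
      simp only [hallSpread, mem_graphLine] at h h'
      have hx : x = 0 := by
        by_cases ht : (t : k) = t'
        · by_contra hx
          refine hij (congrArg Sum.inr (Prod.ext (Units.ext ht) ((algebraMap k E).injective
            (mul_right_cancel₀ hx ?_))))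
          rw [ht] at h
          linear_combination h' - h
        · refine hc' (t - t') (s - s') x (sub_ne_zero.mpr ht) ?_
          rw [map_sub, map_sub]
          linear_combination h' - h
      subst hx
      simpa using h

/-- Desarguesian lines are `E`-subspaces. A sheared graph line has a nonzero `φ`-part, detected by
comparing its points over `1` and `ω`; a sheared Baer line meets `0 × E` without being equal to it.
-/
theorem desarguesianSpread_ne_map_shear_hallSpread {φ : E ≃ₐ[k] E} {ω c δ : E}
    (hω : ω ∉ Set.range (algebraMap k E)) (hφ : φ ω ≠ ω) (hδ : δ ≠ 0) {a b : E} (ha : a ≠ 0)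
    (j : Option E) (j' : Option k ⊕ (kˣ × k)) :
    desarguesianSpread φ j ≠ (hallSpread φ ω c δ j').map (shear k a b) := by
  intro h
  rcases j' with m | ⟨t, s⟩
  · have hμ := projPoint_ne_zero hω m
    have h1 : (a * projPoint ω m, b * projPoint ω m) ∈ desarguesianSpread φ j := by
      rw [h]
      exact ⟨(projPoint ω m, 0), mem_scaledLine.mpr ⟨1, 0, by simp, by simp⟩, by
        simp [shear_apply]⟩
    have h2 : (0, projPoint ω m) ∈ desarguesianSpread φ j := by
      rw [h]
      exact ⟨(0, projPoint ω m), mem_scaledLine.mpr ⟨0, 1, by simp, by simp⟩, by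
        simp [shear_apply]⟩
    rcases j with _ | d
    · obtain ⟨y, hy⟩ := h1
      exact mul_ne_zero ha hμ (congrArg Prod.fst hy).symm
    · rw [desarguesianSpread, mem_graphLine] at h2
      simp [hμ] at h2
  · have h1 : ∀ x, (a * x, b * x + ((algebraMap k E s + algebraMap k E t * c) * x +
        algebraMap k E t * δ * φ x)) ∈ desarguesianSpread φ j := by
      intro x
      rw [h]
      exact ⟨(x, _), mem_graphLine.mpr rfl, rfl⟩
    rcases j with _ | d
    · obtain ⟨y, hy⟩ := h1 1
      exact mul_ne_zero ha one_ne_zero (congrArg Prod.fst hy).symm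
    · have h2 := h1 1
      have h3 := h1 ω
      simp only [desarguesianSpread, mem_graphLine, map_one] at h2 h3
      have ht : algebraMap k E t ≠ 0 := (map_ne_zero _).mpr t.ne_zero
      have h4 : algebraMap k E t * δ * (φ ω - ω) = 0 := by linear_combination h3 - ω * h2
      exact mul_ne_zero (mul_ne_zero ht hδ) (sub_ne_zero.mpr hφ) h4

/-- A line common to two images determines the shear. For Baer lines, the point `(0, μ)` fixes `μ`,
and the image of `(μ, 0)` then fixes the two parameters. For graph lines, the `φ`-coefficient forces
the ratio of the two scale factors into `k`, and the linear coefficient modulo `k` fixes the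
multiple of `ω`. -/
theorem map_shear_hallSpread_ne {φ : E ≃ₐ[k] E} {ω c δ : E}
    (hω : ω ∉ Set.range (algebraMap k E)) (hφ : φ ω ≠ ω) (hδ : δ ≠ 0) {m m' : Option k} {x x' : k}
    (hne : (m, x) ≠ (m', x')) (j j' : Option k ⊕ (kˣ × k)) :
    (hallSpread φ ω c δ j).map (shear k (projPoint ω m) (x • ω)) ≠
      (hallSpread φ ω c δ j').map (shear k (projPoint ω m') (x' • ω)) := by
  have hx : ∀ y : k, x • ω = x' • ω + algebraMap k E y → x = x' := fun y h =>
    sub_eq_zero.mp (eq_zero_of_smul_mem_range hω (y := y) (by rw [sub_smul, h]; ring))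
  have ha := projPoint_ne_zero hω m
  have ha' := projPoint_ne_zero hω m'
  have h0 : ∀ (m m' : Option k) (x x' : k) (n : Option k) (i : kˣ × k),
      (hallSpread φ ω c δ (.inl n)).map (shear k (projPoint ω m) (x • ω)) ≠
        (hallSpread φ ω c δ (.inr i)).map (shear k (projPoint ω m') (x' • ω)) := by
    intro m m' x x' n i h
    have h1 : ((0 : E), projPoint ω n) ∈
        (hallSpread φ ω c δ (.inr i)).map (shear k (projPoint ω m') (x' • ω)) := by
      rw [← h]
      exact ⟨(0, projPoint ω n), mem_scaledLine.mpr ⟨0, 1, by simp, by simp⟩, by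
        simp [shear_apply]⟩
    obtain ⟨⟨u, v⟩, huv, h2⟩ := h1
    rw [SetLike.mem_coe, hallSpread, mem_graphLine] at huv
    obtain ⟨h3, h4⟩ := Prod.ext_iff.mp h2
    obtain rfl : u = 0 := (mul_eq_zero.mp h3).resolve_left (projPoint_ne_zero hω m')
    have h5 : v = 0 := by simpa using huv
    subst h5
    exact projPoint_ne_zero hω n (by simpa [shear_apply] using h4.symm)
  rcases j with n | i <;> rcases j' with n' | i'
  · intro h
    have h1 : ((0 : E), projPoint ω n) ∈
        (hallSpread φ ω c δ (.inl n')).map (shear k (projPoint ω m') (x' • ω)) := by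
      rw [← h]
      exact ⟨(0, projPoint ω n), mem_scaledLine.mpr ⟨0, 1, by simp, by simp⟩, by
        simp [shear_apply]⟩
    have h2 : (projPoint ω m * projPoint ω n, x • ω * projPoint ω n) ∈
        (hallSpread φ ω c δ (.inl n')).map (shear k (projPoint ω m') (x' • ω)) := by
      rw [← h]
      exact ⟨(projPoint ω n, 0), mem_scaledLine.mpr ⟨1, 0, by simp, by simp⟩, by
        simp [shear_apply]⟩
    obtain ⟨⟨u, v⟩, huv, h3⟩ := h1
    obtain ⟨u, v, rfl, rfl⟩ := mem_scaledLine.mp huv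
    obtain ⟨h4, h5⟩ := Prod.ext_iff.mp h3
    have h6 : u • projPoint ω n' = 0 := (mul_eq_zero.mp h4).resolve_left ha'
    simp only [shear_apply, h6, mul_zero, zero_add] at h5
    obtain ⟨rfl, -⟩ := projPoint_eq_smul hω h5.symm
    obtain ⟨⟨u', v'⟩, huv', h7⟩ := h2
    obtain ⟨u', v', rfl, rfl⟩ := mem_scaledLine.mp huv'
    obtain ⟨h8, h9⟩ := Prod.ext_iff.mp h7
    have hn := projPoint_ne_zero hω n
    obtain ⟨rfl, rfl⟩ := projPoint_eq_smul hω (m := m) (m' := m') (u := u')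
      (mul_right_cancel₀ hn (by
        simp only [shear_apply, Algebra.smul_def] at h8 ⊢
        linear_combination -h8))
    refine hne (Prod.ext rfl (hx v' (mul_right_cancel₀ hn ?_)))
    simp only [shear_apply, Algebra.smul_def, map_one] at h9 ⊢
    linear_combination -h9
  · exact h0 _ _ _ _ _ _
  · exact (h0 _ _ _ _ _ _).symm
  · obtain ⟨t, s⟩ := i
    obtain ⟨t', s'⟩ := i'
    intro h
    have h1 : ∀ z, ∃ z', projPoint ω m * z = projPoint ω m' * z' ∧
        (x • ω + algebraMap k E s + algebraMap k E t * c) * z + algebraMap k E t * δ * φ z =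
        (x' • ω + algebraMap k E s' + algebraMap k E t' * c) * z' +
          algebraMap k E t' * δ * φ z' := by
      intro z
      have h2 : shear k (projPoint ω m) (x • ω) (z, (algebraMap k E s + algebraMap k E t * c) * z +
          algebraMap k E t * δ * φ z) ∈
          (hallSpread φ ω c δ (.inr (t', s'))).map (shear k (projPoint ω m') (x' • ω)) := by
        rw [← h]
        exact ⟨_, mem_graphLine.mpr rfl, rfl⟩
      obtain ⟨⟨z', w⟩, hz, h3⟩ := h2
      rw [SetLike.mem_coe, hallSpread, mem_graphLine] at hz
      obtain ⟨h4, h5⟩ := Prod.ext_iff.mp h3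
      refine ⟨z', h4.symm, ?_⟩
      simp only [shear_apply] at h5 hz
      linear_combination -h5 + hz
    -- Here `ρ` is the ratio of the two scale factors, so that `z' = ρ z` throughout.
    obtain ⟨ρ, h2, h3⟩ := h1 1
    obtain ⟨ρ', h4, h5⟩ := h1 ω
    obtain rfl : ρ' = ρ * ω := mul_left_cancel₀ ha' (by linear_combination ω * h2 - h4)
    simp only [map_mul, map_one] at h3 h5
    have ht : algebraMap k E t ≠ 0 := (map_ne_zero _).mpr t.ne_zero
    have ht' : algebraMap k E t' ≠ 0 := (map_ne_zero _).mpr t'.ne_zero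
    have h6 : algebraMap k E t = algebraMap k E t' * φ ρ := by
      refine mul_left_cancel₀ (mul_ne_zero hδ (sub_ne_zero.mpr hφ)) ?_
      linear_combination h5 - ω * h3
    have h7 : ρ = algebraMap k E (t'⁻¹ * t : kˣ) := by
      apply φ.injective
      rw [AlgEquiv.commutes, Units.val_mul, map_mul, Units.val_inv_eq_inv_val, map_inv₀, h6,
        inv_mul_cancel_left₀ ht']
    obtain ⟨rfl, h8⟩ := projPoint_eq_smul hω (m := m) (m' := m') (u := (t'⁻¹ * t : kˣ)) (by
      rw [Algebra.smul_def, ← h7]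
      linear_combination h2)
    have h9 : t = t' := (inv_mul_eq_one.mp (Units.ext h8)).symm
    rw [h8, map_one] at h7
    subst h7 h9
    refine hne (Prod.ext rfl (hx (s' - s) ?_))
    rw [map_sub]
    simp only [map_one] at h3
    linear_combination h3

theorem hasParallelism_of_quadraticExtension [Finite k] [Finite E] {φ : E ≃ₐ[k] E} {ω c δ : E}
    (hE : Module.finrank k E = 2) (hω : ω ∉ Set.range (algebraMap k E)) (hφ : φ ω ≠ ω)
    (hδ : δ ≠ 0) (hc : ∀ (s : k) (z : E), (algebraMap k E s + c) * z + δ * φ z = 0 → z = 0) :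
    HasParallelism k (E × E) := by
  have : Module.Finite k E := Module.Finite.of_finite
  have hq : 0 < Nat.card k := Nat.card_pos
  -- One Desarguesian spread and `(q + 1) q` sheared Hall spreads.
  have hI : Nat.card (Option (Option k × k)) = Nat.card k ^ 2 + Nat.card k + 1 := by
    simp [Finite.card_option, Nat.card_prod]
    ring
  have hJ : Nat.card (Option E) = Nat.card k ^ 2 + 1 := by
    rw [Finite.card_option, Module.natCard_eq_pow_finrank (K := k), hE]
  have hJ' : Nat.card (Option k ⊕ (kˣ × k)) = Nat.card k ^ 2 + 1 := by
    rw [Nat.card_sum, Finite.card_option, Nat.card_prod, Nat.card_units]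
    obtain ⟨n, hn⟩ := Nat.exists_eq_add_of_le' hq
    rw [hn, Nat.add_sub_cancel]
    ring
  let e := Finite.equivFinOfCardEq hI
  let f := Finite.equivFinOfCardEq hJ
  let f' := Finite.equivFinOfCardEq hJ'
  let P : Option (Option k × k) → Fin (Nat.card k ^ 2 + 1) → Submodule k (E × E)
    | none => desarguesianSpread φ ∘ f.symm
    | some p => (fun j => (hallSpread φ ω c δ j).map (shear k (projPoint ω p.1) (p.2 • ω))) ∘ f'.symm
  refine ⟨P ∘ e.symm, fun i => ?_, fun i i' hii j j' => ?_⟩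
  · simp only [Function.comp_apply]
    rcases e.symm i with _ | p
    · exact (isCodeFamily_desarguesianSpread φ hE).comp f.symm.injective
    · exact ((isCodeFamily_hallSpread hE hω hc).map _
        (shear_injective (projPoint_ne_zero hω _) _)).comp f'.symm.injective
  · have hne := e.symm.injective.ne hii
    simp only [Function.comp_apply]
    revert hne
    rcases e.symm i with _ | p <;> rcases e.symm i' with _ | p' <;> intro hne
    · exact absurd rfl hne
    · exact desarguesianSpread_ne_map_shear_hallSpread hω hφ hδ (projPoint_ne_zero hω _) _ _
    · exact (desarguesianSpread_ne_map_shear_hallSpread hω hφ hδ (projPoint_ne_zero hω _) _ _).symm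
    · exact map_shear_hallSpread_ne hω hφ hδ (fun h => hne (congrArg some h)) _ _

end QuadraticExtension

/-! ### Norm conditions and existence for `q > 2` -/

theorem exists_algEquiv_ne (k E : Type*) [Field k] [Field E] [Finite E] [Algebra k E]
    (hE : Module.finrank k E = 2) :
    ∃ φ : E ≃ₐ[k] E, (∀ x ∉ Set.range (algebraMap k E), φ x ≠ x) ∧
      (∀ x, algebraMap k E (Algebra.norm k x) = x * φ x) ∧
      ∀ x, algebraMap k E (Algebra.trace k E x) = x + φ x := by
  have := Finite.of_injective _ (algebraMap k E).injective
  have := Fintype.ofFinite k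
  have hφ : ∀ x, FiniteField.frobeniusAlgEquivOfAlgebraic k E x = x ^ Nat.card k := fun x => by
    simp
  refine ⟨FiniteField.frobeniusAlgEquivOfAlgebraic k E, fun x hx h => hx ?_, fun x => ?_,
    fun x => ?_⟩
  · have h1 : x ∈ (⊥ : IntermediateField k E) := by
      rw [IsGalois.mem_bot_iff_fixed]
      intro f
      obtain ⟨i, rfl⟩ := (FiniteField.bijective_frobeniusAlgEquivOfAlgebraic_pow k E).2 f
      have hi : ∀ n : ℕ, (FiniteField.frobeniusAlgEquivOfAlgebraic k E ^ n) x = x := by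
        intro n
        induction n with
        | zero => rfl
        | succ n ih => rw [pow_succ, AlgEquiv.mul_apply, h, ih]
      exact hi i
    exact IntermediateField.mem_bot.mp h1
  · rw [FiniteField.algebraMap_norm_eq_prod_pow, hE, hφ]
    simp [Finset.prod_range_succ]
  · rw [FiniteField.algebraMap_trace_eq_sum_pow, hE, hφ]
    simp [Finset.sum_range_succ]

/-- If `N(s + c)` differs from `N(δ)` for all `s`, then all the maps `x ↦ (s + c) x + δ φ(x)`
are injective. -/
theorem eq_zero_of_norm_ne {k E : Type*} [Field k] [Field E] [Finite E] [Algebra k E]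
    (hE : Module.finrank k E = 2) (φ : E ≃ₐ[k] E) {c δ : E}
    (h : ∀ s : k, Algebra.norm k (algebraMap k E s + c) ≠ Algebra.norm k δ) (s : k) (z : E)
    (hz : (algebraMap k E s + c) * z + δ * φ z = 0) : z = 0 := by
  by_contra hz0
  have : Module.Finite k E := Module.Finite.of_finite
  refine h s (mul_right_cancel₀ (Algebra.norm_ne_zero_iff.mpr hz0) ?_)
  have h1 : (algebraMap k E s + c) * z = algebraMap k E (-1) * (δ * φ z) := by
    rw [map_neg, map_one]
    linear_combination hz
  rw [← map_mul, h1, map_mul, map_mul, Algebra.norm_algebraMap, hE, Algebra.norm_eq_of_algEquiv φ z]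
  ring

/-- For odd `q` take `c = 0` and `N(δ)` a nonsquare, as `N(s) = s ^ 2`. For even `q` take `c = ω`
and `N(δ) = x (x + Tr ω)`: equality of norms would give `N(s + x + ω) = 0`. Having more than two
elements allows `x` to avoid `0` and `Tr ω`, so that `δ ≠ 0`. -/
theorem exists_norm_ne {k E : Type*} [Field k] [Field E] [Finite E] [Algebra k E]
    (hE : Module.finrank k E = 2) (hk : 2 < Nat.card k) {ω : E}
    (hω : ω ∉ Set.range (algebraMap k E)) :
    ∃ c δ : E, δ ≠ 0 ∧ ∀ s : k, Algebra.norm k (algebraMap k E s + c) ≠ Algebra.norm k δ := by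
  have := Finite.of_injective _ (algebraMap k E).injective
  have : Module.Finite k E := Module.Finite.of_finite
  by_cases h2 : ringChar k = 2
  · have : CharP k 2 := h2 ▸ ringChar.charP k
    have : CharP E 2 := charP_of_injective_algebraMap (algebraMap k E).injective 2
    obtain ⟨φ, -, hn, ht⟩ := exists_algEquiv_ne k E hE
    obtain ⟨x, hx0, hxT⟩ : ∃ x : k, x ≠ 0 ∧ x ≠ Algebra.trace k E ω := by
      by_contra! h
      have hsub : (Set.univ : Set k) ⊆ {0, Algebra.trace k E ω} := fun x _ => by
        by_cases hx : x = 0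
        · exact Or.inl hx
        · exact Or.inr (h x hx)
      have h1 := (Set.ncard_le_ncard hsub (Set.toFinite _)).trans (Set.ncard_insert_le _ _)
      rw [Set.ncard_univ, Set.ncard_singleton] at h1
      omega
    obtain ⟨δ, hδ⟩ := FiniteField.norm_surjective k E (x * (x + Algebra.trace k E ω))
    have hx : x + Algebra.trace k E ω ≠ 0 := fun h => hxT (by rw [CharTwo.add_eq_zero.mp h])
    refine ⟨ω, δ, ?_, fun s hs => ?_⟩
    · rintro rfl
      rw [Algebra.norm_zero] at hδ
      exact mul_ne_zero hx0 hx hδ.symm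
    · have h3 := congrArg (algebraMap k E) (hs.trans hδ)
      rw [hn, map_mul, map_add, map_add, AlgEquiv.commutes, ht] at h3
      have h4 : (2 : E) = 0 := CharTwo.two_eq_zero
      have h5 : (algebraMap k E (s + x) + ω) * (algebraMap k E (s + x) + φ ω) = 0 := by
        rw [map_add]
        linear_combination h3 + (algebraMap k E x * algebraMap k E s + algebraMap k E x ^ 2 +
          algebraMap k E x * ω + algebraMap k E x * φ ω) * h4
      have h6 : algebraMap k E (s + x) + ω ≠ 0 := fun h =>
        hω ⟨-(s + x), by rw [map_neg]; linear_combination -h⟩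
      refine h6 (φ.injective ?_)
      rw [map_add, AlgEquiv.commutes, map_zero]
      exact (mul_eq_zero.mp h5).resolve_left h6
  · obtain ⟨m, hm⟩ := FiniteField.exists_nonsquare h2
    obtain ⟨δ, rfl⟩ := FiniteField.norm_surjective k E m
    refine ⟨0, δ, ?_, fun s hs => hm ⟨s, ?_⟩⟩
    · rintro rfl
      exact hm ⟨0, by simp⟩
    · rw [← hs, add_zero, Algebra.norm_algebraMap, hE, sq]

theorem HasParallelism.of_linearEquiv {k V V' : Type*} [Field k] [AddCommGroup V] [Module k V]
    [AddCommGroup V'] [Module k V'] (e : V ≃ₗ[k] V') (h : HasParallelism k V) :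
    HasParallelism k V' := by
  obtain ⟨P, hP, hne⟩ := h
  exact ⟨fun i j => (P i j).map e.toLinearMap, fun i => (hP i).map _ e.injective,
    fun i i' hii j j' h => hne i i' hii j j' (Submodule.map_injective_of_injective e.injective h)⟩

theorem hasParallelism_of_two_lt {k V : Type*} [Field k] [Finite k] [AddCommGroup V] [Module k V]
    [Module.Finite k V] (hk : 2 < Nat.card k) (hV : Module.finrank k V = 4) :
    HasParallelism k V := by
  obtain ⟨E, _, _, _, hE⟩ := exists_finite_extension k 2 two_ne_zero
  have : Module.Finite k E := Module.Finite.of_finite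
  have hω : ∃ ω, ω ∉ Set.range (algebraMap k E) := by
    by_contra! h
    have := LinearMap.finrank_le_finrank_of_surjective (f := Algebra.linearMap k E) h
    rw [hE, Module.finrank_self] at this
    omega
  obtain ⟨ω, hω⟩ := hω
  obtain ⟨φ, hφ, -⟩ := exists_algEquiv_ne k E hE
  obtain ⟨c, δ, hδ, hc⟩ := exists_norm_ne hE hk hω
  refine (hasParallelism_of_quadraticExtension hE hω (hφ ω hω) hδ
    (eq_zero_of_norm_ne hE φ hc)).of_linearEquiv (LinearEquiv.ofFinrankEq _ _ ?_)
  rw [Module.finrank_prod, hE, hV]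

/-! ### The explicit parallelism for `q = 2` -/

section BinaryField

/-- The vector of `k ^ 4` whose entries are the binary digits of a natural number. -/
def bitVector (k : Type*) [Field k] (n : ℕ) : Fin 4 → k :=
  fun i => if n.testBit i then 1 else 0

variable {k : Type*} [Field k]

theorem bitVector_zero : bitVector k 0 = 0 := by
  ext i
  simp [bitVector]

theorem bitVector_xor [CharP k 2] (a b : ℕ) :
    bitVector k (a ^^^ b) = bitVector k a + bitVector k b := by
  ext i
  rcases h : a.testBit i <;> rcases h' : b.testBit i <;>
    simp [bitVector, h, h', CharTwo.add_self_eq_zero]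

theorem bitVector_injOn {a b : ℕ} (ha : a < 16) (hb : b < 16)
    (h : bitVector k a = bitVector k b) : a = b := by
  refine Nat.eq_of_testBit_eq fun i => ?_
  by_cases hi : i < 4
  · have := congrFun h ⟨i, hi⟩
    rcases h : a.testBit i <;> rcases h' : b.testBit i <;> simp_all [bitVector]
  · have h16 : 2 ^ 4 ≤ 2 ^ i := Nat.pow_le_pow_right two_pos (not_lt.mp hi)
    rw [Nat.testBit_lt_two_pow (ha.trans_le h16), Nat.testBit_lt_two_pow (hb.trans_le h16)]

theorem eq_zero_or_eq_one_of_natCard (hk : Nat.card k = 2) (x : k) : x = 0 ∨ x = 1 := by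
  have := Nat.finite_of_card_ne_zero (hk ▸ two_ne_zero)
  have := Fintype.ofFinite k
  rw [or_iff_not_imp_left]
  intro hx
  have h := FiniteField.pow_card_sub_one_eq_one x hx
  rwa [← Nat.card_eq_fintype_card, hk, pow_one] at h

variable (k) in
/-- The line spanned by two vectors given by their binary digits. -/
def bitLine (p : ℕ × ℕ) : Submodule k (Fin 4 → k) :=
  Submodule.span k {bitVector k p.1, bitVector k p.2}

theorem mem_bitLine (hk : Nat.card k = 2) [CharP k 2] {p : ℕ × ℕ} {z : Fin 4 → k} :
    z ∈ bitLine k p ↔ ∃ x ∈ [0, p.1, p.2, p.1 ^^^ p.2], z = bitVector k x := by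
  rw [bitLine, Submodule.mem_span_pair]
  constructor
  · rintro ⟨s, t, rfl⟩
    rcases eq_zero_or_eq_one_of_natCard hk s with rfl | rfl <;>
      rcases eq_zero_or_eq_one_of_natCard hk t with rfl | rfl <;>
      simp [bitVector_zero, bitVector_xor]
  · rintro ⟨x, hx, rfl⟩
    simp only [List.mem_cons, List.not_mem_nil, or_false] at hx
    rcases hx with rfl | rfl | rfl | rfl
    · exact ⟨0, 0, by simp [bitVector_zero]⟩
    · exact ⟨1, 0, by simp⟩
    · exact ⟨0, 1, by simp⟩
    · exact ⟨1, 1, by simp [bitVector_xor]⟩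

theorem finrank_bitLine (hk : Nat.card k = 2) [CharP k 2] {p : ℕ × ℕ} (h1 : p.1 < 16)
    (h2 : p.2 < 16) (h1' : p.1 ≠ 0) (h2' : p.2 ≠ 0) (h12 : p.1 ≠ p.2) :
    Module.finrank k (bitLine k p) = 2 := by
  have hli : LinearIndependent k ![bitVector k p.1, bitVector k p.2] := by
    have hv1 : bitVector k p.1 ≠ 0 := fun h =>
      h1' (bitVector_injOn h1 (by norm_num) (h.trans bitVector_zero.symm))
    have hv2 : bitVector k p.2 ≠ 0 := fun h =>
      h2' (bitVector_injOn h2 (by norm_num) (h.trans bitVector_zero.symm))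
    have hv12 : bitVector k p.1 + bitVector k p.2 ≠ 0 := fun h =>
      h12 (bitVector_injOn h1 h2 (by
        ext i
        exact CharTwo.add_eq_zero.mp (congrFun h i)))
    rw [LinearIndependent.pair_iff]
    intro s t hst
    rcases eq_zero_or_eq_one_of_natCard hk s with rfl | rfl <;>
      rcases eq_zero_or_eq_one_of_natCard hk t with rfl | rfl <;> simp_all
  have := finrank_span_eq_card hli
  rwa [Matrix.range_cons, Matrix.range_cons, Matrix.range_empty, Set.union_empty,
    Set.singleton_union, Fintype.card_fin] at this

/-- A parallelism of the four-dimensional space over the field with two elements. -/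
def binaryParallelism : Fin 7 → Fin 5 → ℕ × ℕ :=
  ![![(1, 2), (4, 8), (5, 10), (6, 11), (7, 9)],
    ![(1, 4), (2, 8), (3, 13), (6, 9), (7, 11)],
    ![(1, 6), (2, 9), (3, 12), (4, 10), (5, 8)],
    ![(1, 8), (2, 12), (3, 5), (4, 11), (7, 10)],
    ![(1, 10), (2, 13), (3, 4), (5, 9), (6, 8)],
    ![(1, 12), (2, 4), (3, 9), (5, 11), (7, 8)],
    ![(1, 14), (2, 5), (3, 8), (4, 9), (6, 10)]]

/-- Addition of vectors is XOR of their binary codes, so all incidences become finite checks on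
numbers below 16. -/
theorem hasParallelism_of_natCard_eq_two (hk : Nat.card k = 2) :
    HasParallelism k (Fin 4 → k) := by
  have := Nat.finite_of_card_ne_zero (hk ▸ two_ne_zero)
  have : CharP k 2 := by
    refine CharTwo.of_one_ne_zero_of_two_eq_zero one_ne_zero ?_
    rw [← one_add_one_eq_two]
    exact (eq_zero_or_eq_one_of_natCard hk _).resolve_right fun h => by simp at h
  have hA : ∀ i j, (binaryParallelism i j).1 < 16 ∧ (binaryParallelism i j).2 < 16 ∧
      (binaryParallelism i j).1 ≠ 0 ∧ (binaryParallelism i j).2 ≠ 0 ∧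
      (binaryParallelism i j).1 ≠ (binaryParallelism i j).2 := by decide
  have hX : ∀ i j, (binaryParallelism i j).1 ^^^ (binaryParallelism i j).2 < 16 := by decide
  have hB : ∀ i j j', j ≠ j' →
      ∀ x ∈ [0, (binaryParallelism i j).1, (binaryParallelism i j).2,
        (binaryParallelism i j).1 ^^^ (binaryParallelism i j).2],
      ∀ y ∈ [0, (binaryParallelism i j').1, (binaryParallelism i j').2,
        (binaryParallelism i j').1 ^^^ (binaryParallelism i j').2], x = y → x = 0 := by decide
  have hC : ∀ i i', i ≠ i' → ∀ j j',
      ¬((binaryParallelism i j).1 ∈ [0, (binaryParallelism i' j').1, (binaryParallelism i' j').2,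
        (binaryParallelism i' j').1 ^^^ (binaryParallelism i' j').2] ∧
      (binaryParallelism i j).2 ∈ [0, (binaryParallelism i' j').1, (binaryParallelism i' j').2,
        (binaryParallelism i' j').1 ^^^ (binaryParallelism i' j').2]) := by decide
  have hlt : ∀ i j, ∀ x ∈ [0, (binaryParallelism i j).1, (binaryParallelism i j).2,
        (binaryParallelism i j).1 ^^^ (binaryParallelism i j).2], x < 16 := by
    intro i j
    simpa using ⟨(hA i j).1, (hA i j).2.1, hX i j⟩
  rw [HasParallelism, hk]
  refine ⟨fun i j => bitLine k (binaryParallelism i j), fun i => ⟨fun j => ?_, fun j j' hj => ?_⟩,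
    fun i i' hi j j' h => hC i i' hi j j' ⟨?_, ?_⟩⟩
  · obtain ⟨h1, h2, h3, h4, h5⟩ := hA i j
    exact finrank_bitLine hk h1 h2 h3 h4 h5
  · refine finrank_inf_le_zero_of_forall fun z hz hz' => ?_
    obtain ⟨x, hx, rfl⟩ := (mem_bitLine hk).mp hz
    obtain ⟨y, hy, hxy⟩ := (mem_bitLine hk).mp hz'
    rw [hB i j j' hj x hx y hy (bitVector_injOn (hlt i j x hx) (hlt i j' y hy) hxy),
      bitVector_zero]
  · dsimp only at h
    have h1 : bitVector k (binaryParallelism i j).1 ∈ bitLine k (binaryParallelism i' j') :=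
      h ▸ (mem_bitLine hk).mpr ⟨_, by simp, rfl⟩
    obtain ⟨x, hx, hxy⟩ := (mem_bitLine hk).mp h1
    rwa [bitVector_injOn (hA i j).1 (hlt i' j' x hx) hxy]
  · dsimp only at h
    have h1 : bitVector k (binaryParallelism i j).2 ∈ bitLine k (binaryParallelism i' j') :=
      h ▸ (mem_bitLine hk).mpr ⟨_, by simp, rfl⟩
    obtain ⟨x, hx, hxy⟩ := (mem_bitLine hk).mp h1
    rwa [bitVector_injOn (hA i j).2.1 (hlt i' j' x hx) hxy]

end BinaryField

theorem hasParallelism {k V : Type*} [Field k] [Finite k] [AddCommGroup V] [Module k V]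
    [Module.Finite k V] (hV : Module.finrank k V = 4) : HasParallelism k V := by
  rcases (Nat.succ_le_of_lt (Finite.one_lt_card (α := k))).eq_or_lt with hk | hk
  · exact (hasParallelism_of_natCard_eq_two hk.symm).of_linearEquiv
      (LinearEquiv.ofFinrankEq _ _ (by rw [Module.finrank_fin_fun, hV]))
  · exact hasParallelism_of_two_lt hk hV

/-! ### Partial spreads and the final bounds -/

theorem HasCode.fin_add {k : Type*} [Field k] {d a N m n : ℕ}
    (h : HasCode k ((Fin m → k) × (Fin n → k)) d a N) : HasCode k (Fin (m + n) → k) d a N :=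
  h.of_finrank_eq (by simp)

/-- Distinct pairs differ in a coordinate, where the lines are disjoint; the other coordinate
contributes at most 2. -/
theorem finrank_inf_add_finrank_inf_le_two {k T S : Type*} [Field k] [AddCommGroup T] [Module k T]
    [AddCommGroup S] [Module k S] [Module.Finite k T] [Module.Finite k S] {M N : ℕ}
    {L : Fin M → Submodule k S} {U : Fin N → Submodule k T} (hL : IsCodeFamily 2 0 L)
    (hU : IsCodeFamily 2 0 U) (p p' : Fin M × Fin N) (hp : p ≠ p') :
    Module.finrank k (L p.1 ⊓ L p'.1 : Submodule k S) +
      Module.finrank k (U p.2 ⊓ U p'.2 : Submodule k T) ≤ 2 := by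
  by_cases h : p.1 = p'.1
  · have h2 := hU.2 p.2 p'.2 fun h' => hp (Prod.ext h h')
    have h3 := (Submodule.finrank_mono (inf_le_left : L p.1 ⊓ L p'.1 ≤ L p.1)).trans (hL.1 p.1).le
    omega
  · have h2 := hL.2 p.1 p'.1 h
    have h3 := (Submodule.finrank_mono (inf_le_left : U p.2 ⊓ U p'.2 ≤ U p.2)).trans (hU.1 p.2).le
    omega

theorem hasCode_line (k : Type*) [Field k] {n : ℕ} (hn : 2 ≤ n) : HasCode k (Fin n → k) 2 0 1 := by
  obtain ⟨f, hf⟩ := (finrank_le_iff_exists_linearMap (R := k) (M := Fin 2 → k)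
    (M' := Fin n → k)).mp (by simpa using hn)
  refine ⟨fun _ => LinearMap.range f, fun _ => ?_, fun i j hij => absurd (Subsingleton.elim i j) hij⟩
  rw [LinearMap.finrank_range_of_inj hf, Module.finrank_fin_fun]

section Bounds

variable (k : Type*) [Field k] [Finite k]

theorem hasCode_spread_four : HasCode k (Fin 4 → k) 2 0 (Nat.card k ^ 2 + 1) :=
  (HasCode.line_spread_step (T := Fin 2 → k) (by simp) le_rfl (by simp)
    (hasCode_line k le_rfl)).fin_add

theorem hasCode_spread_five : HasCode k (Fin 5 → k) 2 0 (Nat.card k ^ 3 + 1) :=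
  (HasCode.line_spread_step (T := Fin 2 → k) (by simp) (by norm_num) (by simp)
    (hasCode_line k (n := 3) (by norm_num))).fin_add

theorem hasCode_spread_six :
    HasCode k (Fin 6 → k) 2 0 (Nat.card k ^ 4 + (Nat.card k ^ 2 + 1)) :=
  (HasCode.line_spread_step (T := Fin 2 → k) (by simp) (by norm_num) (by simp)
    (hasCode_spread_four k)).fin_add

theorem hasCode_spread_eight : HasCode k (Fin 8 → k) 2 0
    (Nat.card k ^ 6 + (Nat.card k ^ 4 + (Nat.card k ^ 2 + 1))) :=
  (HasCode.line_spread_step (T := Fin 2 → k) (by simp) (by norm_num) (by simp)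
    (hasCode_spread_six k)).fin_add

/-- `A_q(8,4;4) ≥ q ^ 12 + q ^ 2 (q ^ 2 + 1) ^ 2 (q ^ 2 + q + 1) + 1`. -/
theorem hasCode_eight : HasCode k (Fin 8 → k) 4 2
    (Nat.card k ^ 12 + (Nat.card k ^ 2 + Nat.card k + 1) *
      ((Nat.card k ^ 2 + 1) * (Nat.card k ^ 2 + 1)) * Nat.card k ^ 2 + 1) := by
  have hV : Module.finrank k (Fin 4 → k) = 4 := by simp
  obtain ⟨P, hP, hne⟩ := hasParallelism hV
  have hT : HasCode k (Fin 4 → k) 4 2 1 :=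
    ⟨fun _ => ⊤, fun _ => by rw [finrank_top, hV], fun i j hij => absurd (Subsingleton.elim i j) hij⟩
  have hle : ∀ i j j', Module.finrank k (P i j ⊓ P i j' : Submodule k (Fin 4 → k)) ≤ 2 :=
    fun i j j' => (Submodule.finrank_mono inf_le_left).trans ((hP i).1 j).le
  have hlt : ∀ i i', i ≠ i' → ∀ j j',
      Module.finrank k (P i j ⊓ P i' j' : Submodule k (Fin 4 → k)) ≤ 1 := by
    intro i i' hi j j'
    have h1 := (hP i).1 j
    have h2 := (hP i').1 j'
    by_contra! h
    have e1 := Submodule.eq_of_le_of_finrank_le (inf_le_left : P i j ⊓ P i' j' ≤ P i j) (by omega)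
    have e2 := Submodule.eq_of_le_of_finrank_le (inf_le_right : P i j ⊓ P i' j' ≤ P i' j') (by omega)
    exact hne i i' hi j j' (e1.symm.trans e2)
  -- The triple `(i, j, l)` pairs lines `j` and `l` of the same spread `i`, giving `(q ^ 2 + q + 1)
  -- (q ^ 2 + 1) ^ 2` pairs.
  have h := hT.linkage_succ hV
    (P := Fin (Nat.card k ^ 2 + Nat.card k + 1) ×
      (Fin (Nat.card k ^ 2 + 1) × Fin (Nat.card k ^ 2 + 1)))
    (fun p => P p.1 p.2.1) (fun p => P p.1 p.2.2) (fun p => (hP _).1 _) (fun p => (hP _).1 _) ?_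
  · simpa [Nat.card_prod] using h.fin_add
  · rintro ⟨i, j, l⟩ ⟨i', j', l'⟩ hp
    dsimp only
    by_cases hi : i = i'
    · subst hi
      by_cases hj : j = j'
      · have hl : l ≠ l' := fun hl => hp (by rw [hj, hl])
        exact add_le_add (hle i j j') ((hP i).2 l l' hl)
      · exact (add_le_add ((hP i).2 j j' hj) (hle i l l')).trans (by norm_num)
    · exact add_le_add (hlt i i' hi j j') (hlt i i' hi l l')

variable {k}

/-- Two `d`-spaces have distance `2 d - 2 dim (U ∩ W)`; `a < d` ensures that the members of the
family are distinct. -/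
theorem HasCode.le_maxCodeSize {v d a b N : ℕ} (h : HasCode k (Fin v → k) d a N) (had : a < d)
    (hb : b + 2 * a ≤ 2 * d) : N ≤ maxCodeSize k v b d := by
  classical
  obtain ⟨W, hW⟩ := h
  have hinj : Function.Injective W := by
    intro i j hij
    by_contra hne
    have h1 := hW.2 i j hne
    rw [hij, inf_idem, hW.1] at h1
    omega
  refine (maxCodeSize_isGreatest k v b d).2 ⟨Finset.univ.image W, ⟨?_, ?_⟩, ?_⟩
  · intro U hU
    obtain ⟨i, -, rfl⟩ := Finset.mem_image.mp hU
    exact hW.1 i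
  · intro U hU X hX hne
    obtain ⟨i, -, rfl⟩ := Finset.mem_image.mp hU
    obtain ⟨j, -, rfl⟩ := Finset.mem_image.mp hX
    have h1 := hW.2 i j fun h => hne (h ▸ rfl)
    have h2 := Submodule.finrank_sup_add_finrank_inf_eq (W i) (W j)
    have h3 := hW.1 i
    have h4 := hW.1 j
    rw [subspaceDist]
    omega
  · rw [Finset.card_image_of_injective _ hinj, Finset.card_univ, Fintype.card_fin]

/-- Linkage along a partial line spread of `k ^ (s + 2)` and a partial line spread of `k ^ m`. -/
theorem HasCode.linkage_spread {m s A B C : ℕ} (hs : 2 ≤ s) (hC : HasCode k (Fin m → k) 4 2 C)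
    (hA : HasCode k (Fin m → k) 2 0 A) (hB : HasCode k (Fin (s + 2) → k) 2 0 B) :
    HasCode k (Fin (m + (s + 2)) → k) 4 2
      (C * Nat.card k ^ ((s + 2) * 3) + B * A * Nat.card k ^ s) := by
  obtain ⟨U, hU⟩ := hA
  obtain ⟨L, hL⟩ := hB
  have h := hC.linkage (S := Fin (s + 2) → k) (by simp) hs (fun p : Fin B × Fin A => L p.1)
    (fun p => U p.2) (fun p => hL.1 _) (fun p => hU.1 _)
    (finrank_inf_add_finrank_inf_le_two hL hU)
  rw [Nat.card_prod, Nat.card_fin, Nat.card_fin] at h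
  exact h.fin_add

theorem HasCode.linkage_spread_succ {m A B C : ℕ} (hC : HasCode k (Fin m → k) 4 2 C)
    (hA : HasCode k (Fin m → k) 2 0 A) (hB : HasCode k (Fin 4 → k) 2 0 B) :
    HasCode k (Fin (m + 4) → k) 4 2 (C * Nat.card k ^ 12 + B * A * Nat.card k ^ 2 + 1) := by
  obtain ⟨U, hU⟩ := hA
  obtain ⟨L, hL⟩ := hB
  have h := hC.linkage_succ (S := Fin 4 → k) (by simp) (fun p : Fin B × Fin A => L p.1)
    (fun p => U p.2) (fun p => hL.1 _) (fun p => hU.1 _)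
    (finrank_inf_add_finrank_inf_le_two hL hU)
  rw [Nat.card_prod, Nat.card_fin, Nat.card_fin] at h
  exact h.fin_add

end Bounds

theorem mainTheorem7 (K : Type*) [Field K] [Finite K] (q : ℕ) (hq : Nat.card K = q) :
    q ^ 24 + q ^ 20 + q ^ 19 + 3 * q ^ 18 + 2 * q ^ 17 + 3 * q ^ 16 + q ^ 15 + q ^ 14 + q ^ 12
        + q ^ 10 + 2 * q ^ 8 + 2 * q ^ 6 + 2 * q ^ 4 + q ^ 2 + 1
      ≤ maxCodeSize K 12 4 4 ∧
    q ^ 27 + q ^ 23 + q ^ 22 + 3 * q ^ 21 + 2 * q ^ 20 + 3 * q ^ 19 + q ^ 18 + q ^ 17 + q ^ 15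
        + q ^ 12 + q ^ 10 + q ^ 9 + q ^ 8 + q ^ 7 + q ^ 6 + q ^ 5 + q ^ 3
      ≤ maxCodeSize K 13 4 4 := by
  subst hq
  have h12 := ((hasCode_eight K).linkage_spread_succ (hasCode_spread_eight K)
    (hasCode_spread_four K)).le_maxCodeSize (b := 4) (by norm_num) (by norm_num)
  -- Here 13 = 8 + 5, with a partial spread of `q ^ 3 + 1` lines in dimension 5.
  have h13 := ((hasCode_eight K).linkage_spread (s := 3) (by norm_num) (hasCode_spread_eight K)
    (hasCode_spread_five K)).le_maxCodeSize (b := 4) (by norm_num) (by norm_num)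
  exact ⟨(le_of_eq (by ring)).trans h12, (le_of_eq (by ring)).trans h13⟩
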